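/- A weight is a non-negative locally integrable function $w$ on $\mathbb R$; write $w(E)=\int_E w$. Let $Mf(x)=\sup_{I\ni x}\frac1{|I|}\int_I|f|$ be the Hardy--Littlewood maximal operator (supremum over all bounded intervals $I\subset\mathbb R$ of positive length containing $x$), let $[w]_{A_1}=\|Mw/w\|_{L^\infty}$, and let $Hf(x)=\mathrm{P.V.}\int_{\mathbb R}\frac{f(y)}{x-y}\,dy$ be the Hilbert transform. Put $\|g\|_{L^{1,\infty}(w)}=\sup_{\alpha>0}\alpha\, w\{x:|g(x)|>\alpha\}$, and let $\|H\|_{L^1(w)\to L^{1,\infty}(w)}$ be the least $C\in[0,\infty]$ such that $\|Hf\|_{L^{1,\infty}(w)}\le C\|f\|_{L^1(w)}$ for all real-valued $f\in L^1(w)$. For $t\ge1$ define $$\varphi_H(t)=\sup_{[w]_{A_1}\le t}\|H\|_{L^1(w)\to L^{1,\infty}(w)},$$ the supremum being over all weights $w$ with $[w]_{A_1}\le t$. Theorem. There is an absolute constant $c'>0$ such that $$\varphi_H(t)\ge c'\,t\log(e+t)\qquad\text{for all } t\ge1.$$ In particular, if $\alpha\in\mathbb R$ is such that, for some constant $C$,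 the inequality $$\|Hf\|_{L^{1,\infty}(w)}\le C\,[w]_{A_1}\log^{\alpha}(e+[w]_{A_1})\,\|f\|_{L^1(w)}$$ holds for all weights $w$ with $[w]_{A_1}<\infty$ and all real-valued $f\in L^1(w)$, then $\alpha\ge1$. -/

import Mathlib

open MeasureTheory Filter Topology
open scoped ENNReal

noncomputable section

/-- A weight on `ℝ`: a non-negative locally integrable function. -/
structure IsWeight (w : ℝ → ℝ) : Prop where
  nonneg : ∀ x, 0 ≤ w x
  locallyIntegrable : LocallyIntegrable w volume

/-- The measure `w dx`, so that `weightMeasure w E = w(E)`. -/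
def weightMeasure (w : ℝ → ℝ) : Measure ℝ :=
  volume.withDensity fun x => ENNReal.ofReal (w x)

/-- The (uncentred) Hardy-Littlewood maximal function: the supremum of the averages of `|f|` over
all bounded nondegenerate intervals containing `x`. Endpoints do not change the averages, so
closed intervals give the supremum over intervals of every kind. -/
def hlMaximal (f : ℝ → ℝ) (x : ℝ) : ℝ≥0∞ :=
  ⨆ (a : ℝ) (b : ℝ) (_ : a < b) (_ : x ∈ Set.Icc a b),
    (∫⁻ y in Set.Icc a b, ‖f y‖ₑ) / ENNReal.ofReal (b - a)

/-- `[w]_{A_1} = ‖Mw / w‖_{L^∞}`, with values in `[0, ∞]`. -/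
def a1Const (w : ℝ → ℝ) : ℝ≥0∞ :=
  essSup (fun x => hlMaximal w x / ENNReal.ofReal (w x)) volume

/-- `L` is the principal value at `x` of `∫ f(y) / (x - y) dy`: all the truncated integrals
converge absolutely, and they tend to `L` as the truncation is removed. -/
def HasHilbertPV (f : ℝ → ℝ) (x L : ℝ) : Prop :=
  (∀ ε : ℝ, 0 < ε → IntegrableOn (fun y => f y / (x - y)) {y | ε < |x - y|} volume) ∧
    Tendsto (fun ε : ℝ => ∫ y in {y | ε < |x - y|}, f y / (x - y)) (𝓝[>] 0) (𝓝 L)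

open Classical in
/-- The Hilbert transform `Hf(x) = P.V. ∫ f(y) / (x - y) dy`. The value `0` is used at the points
where the principal value does not exist (a null set if `f ∈ L¹(w)` for a weight `w` that is not
almost everywhere zero and has `[w]_{A_1} < ∞`). -/
def hilbertTransform (f : ℝ → ℝ) (x : ℝ) : ℝ :=
  if h : ∃ L, HasHilbertPV f x L then h.choose else 0

/-- The quasinorm `‖g‖_{L^{1,∞}(μ)} = sup_{α > 0} α μ{|g| > α}`. -/
def weakL1Norm (g : ℝ → ℝ) (μ : Measure ℝ) : ℝ≥0∞ :=
  ⨆ (α : ℝ) (_ : 0 < α), ENNReal.ofReal α * μ {x | α < |g x|}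

/-- The norm of the Hilbert transform from `L¹(w)` to `L^{1,∞}(w)`: the least `C ∈ [0, ∞]` with
`‖Hf‖_{L^{1,∞}(w)} ≤ C ‖f‖_{L¹(w)}` for all `f ∈ L¹(w)`. -/
def hilbertWeakNorm (w : ℝ → ℝ) : ℝ≥0∞ :=
  sInf {C : ℝ≥0∞ | ∀ f : ℝ → ℝ, Integrable f (weightMeasure w) →
    weakL1Norm (hilbertTransform f) (weightMeasure w) ≤ C * eLpNorm f 1 (weightMeasure w)}

/-- `φ_H(t)`: the supremum of `‖H‖_{L¹(w) → L^{1,∞}(w)}` over the weights with `[w]_{A_1} ≤ t`. -/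
def phiH (t : ℝ) : ℝ≥0∞ :=
  ⨆ (w : ℝ → ℝ) (_ : IsWeight w) (_ : a1Const w ≤ ENNReal.ofReal t), hilbertWeakNorm w

/-- The exponent `α` is admissible: there is a constant `C` such that
`‖Hf‖_{L^{1,∞}(w)} ≤ C [w]_{A_1} log^α(e + [w]_{A_1}) ‖f‖_{L¹(w)}`
for all weights `w` with `[w]_{A_1} < ∞` and all `f ∈ L¹(w)`. -/
def AdmissibleLogExponent (α : ℝ) : Prop :=
  ∃ C : ℝ, ∀ w : ℝ → ℝ, IsWeight w → a1Const w ≠ ∞ →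
    ∀ f : ℝ → ℝ, Integrable f (weightMeasure w) →
      weakL1Norm (hilbertTransform f) (weightMeasure w) ≤
        ENNReal.ofReal (C * (a1Const w).toReal *
          Real.log (Real.exp 1 + (a1Const w).toReal) ^ α) * eLpNorm f 1 (weightMeasure w)

end

/-! Fix `L` and let `E_n = middleSet L n`: the points of `[0,1)` whose first `n` digits in base `3L`
lie in the middle third `[L, 2L)`. These sets are nested and `|E_n| = 3^(-n)`. The weight
`nestedWeight L` is comparable to `3^n / L` on `E_n \ E_(n+1)` for `n < L`, but jumps to size `3^L`
on `E_L`, so that `E_L` has mass at least 1.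

An interval containing a point outside `E_p` has average at most `9 * 3^p`: if it meets `E_(p+1)`
inside a cell of generation `p`, it must contain a third of that cell. Hence the `A_1` constant is
at most `18 L` (`a1Const_nestedWeight_le`).

The test function `dipoleSum L` puts, around the middle third of every generation-`n` cell of `E_n`
with `n < L`, the value `+1` on the adjacent subcell to the left and `-1` on the one to the right.
These lie outside `E_(n+1)`, where the weight is small, so the norm is at most `2 / L`
(`eLpNorm_dipoleSum_le`). At a point of `E_L` whose digit of position `n + 1` is `L + j`, the dipole
around it contributes at least `1 / (j + 2)`; all other dipoles together cost only a bounded amount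
because of their cancellation (`hilbertTransform_dipoleSum_ge`). The digits are independent and
uniform on `E_L`, so the sum of the main terms has mean `shiftedHarmonic L`, about `log L`, and
variance no larger than its mean. By Chebyshev it exceeds half its mean on at least half of `E_L`
(`card_large_digitSum`). The weak norm is thus at least `log L / 8`, and division by `2 / L` gives
`L log L / 16` (`le_of_weakL1Norm_dipoleSum_le`). -/

/-! ### ### Nested sets with middle-third digits -/

/-- The integers `3 L m + d` with `m ∈ S` and a digit `d` in the middle third `[L, 2 L)`. -/
noncomputable def middleChildren (L : ℕ) (S : Finset ℤ) : Finset ℤ :=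
  S.biUnion fun m => Finset.Ico (3 * L * m + L) (3 * L * m + 2 * L)

lemma mem_middleChildren {L : ℕ} (hL : 0 < L) {S : Finset ℤ} {y : ℤ} :
    y ∈ middleChildren L S ↔
      y / (3 * L) ∈ S ∧ (L : ℤ) ≤ y % (3 * L) ∧ y % (3 * L) < 2 * L := by
  have hB : (0 : ℤ) < 3 * L := by positivity
  simp only [middleChildren, Finset.mem_biUnion, Finset.mem_Ico]
  constructor
  · rintro ⟨m, hm, h1, h2⟩
    have hdiv : y / (3 * L) = m := by
      rw [Int.ediv_eq_iff_of_pos hB]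
      constructor <;> nlinarith
    have := Int.emod_add_mul_ediv y (3 * L)
    rw [hdiv] at this ⊢
    exact ⟨hm, by linarith, by linarith⟩
  · rintro ⟨hm, h1, h2⟩
    have := Int.emod_add_mul_ediv y (3 * L)
    exact ⟨_, hm, by linarith, by linarith⟩

lemma ediv_middleChild {L : ℕ} {j : ℕ} (hj : j < L) (m : ℤ) :
    (3 * L * m + L + j) / (3 * L : ℤ) = m := by
  have hj' : (j : ℤ) < L := by exact_mod_cast hj
  rw [Int.ediv_eq_iff_of_pos (by linarith)]
  constructor <;> nlinarith

lemma emod_middleChild {L : ℕ} {j : ℕ} (hj : j < L) (m : ℤ) :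
    (3 * L * m + L + j) % (3 * L : ℤ) = L + j := by
  have := Int.emod_add_mul_ediv (3 * L * m + L + j) (3 * L)
  rw [ediv_middleChild hj] at this
  linarith

lemma sum_middleChildren {L : ℕ} (S : Finset ℤ) (φ : ℤ → ℝ) :
    ∑ y ∈ middleChildren L S, φ y = ∑ m ∈ S, ∑ j ∈ Finset.range L, φ (3 * L * m + L + j) := by
  rw [middleChildren, Finset.sum_biUnion]
  · refine Finset.sum_congr rfl fun m _ => ?_
    symm
    refine Finset.sum_bij (fun j _ => 3 * L * m + L + j) ?_ ?_ ?_ ?_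
    · intro j hj
      simp only [Finset.mem_range, Finset.mem_Ico] at hj ⊢
      omega
    · intro a _ b _ h
      simpa using h
    · intro y hy
      simp only [Finset.mem_Ico] at hy
      refine ⟨(y - (3 * L * m + L)).toNat, ?_, ?_⟩
      · simp only [Finset.mem_range]; omega
      · omega
    · intros; rfl
  · intro a _ b _ hab
    refine Finset.disjoint_left.2 fun y h1 h2 => hab ?_
    simp only [Finset.mem_Ico] at h1 h2
    have hL : (0 : ℤ) < L := by linarith
    rcases lt_trichotomy a b with h | h | h
    · nlinarith [mul_le_mul_of_nonneg_left (Int.add_one_le_iff.2 h) hL.le]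
    · exact h
    · nlinarith [mul_le_mul_of_nonneg_left (Int.add_one_le_iff.2 h) hL.le]

lemma card_middleChildren {L : ℕ} (S : Finset ℤ) :
    (middleChildren L S).card = L * S.card := by
  have := sum_middleChildren (L := L) S (fun _ => 1)
  simp only [Finset.sum_const, Finset.card_range, nsmul_eq_mul, mul_one] at this
  rw [mul_comm]
  exact_mod_cast this

/-- The integers `∑ i < n, d i * (3 L) ^ i` whose `n` base `3 L` digits are all in `[L, 2 L)`. -/
noncomputable def middleInts (L n : ℕ) : Finset ℤ := (middleChildren L)^[n] {0}

lemma middleInts_succ (L n : ℕ) : middleInts L (n + 1) = middleChildren L (middleInts L n) :=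
  Function.iterate_succ_apply' _ _ _

lemma card_iterate_middleChildren (L n : ℕ) (k : ℤ) :
    ((middleChildren L)^[n] {k}).card = L ^ n := by
  induction n with
  | zero => simp
  | succ n ih => rw [Function.iterate_succ_apply', card_middleChildren, ih, pow_succ']

/-- Dropping the last base `3 L` digit of a cell's index gives the index of its parent. -/
lemma floor_mul_pow_ediv {L : ℕ} (hL : 0 < L) (x : ℝ) (n : ℕ) :
    ⌊x * (3 * L : ℝ) ^ (n + 1)⌋ / (3 * L : ℤ) = ⌊x * (3 * L : ℝ) ^ n⌋ := by
  have := Int.floor_div_natCast (x * (3 * L : ℝ) ^ (n + 1)) (3 * L)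
  push_cast at this
  rw [← this]
  congr 1
  have : (L : ℝ) ≠ 0 := by positivity
  field_simp
  ring

/-- The union of the `3 L`-adic intervals of generation `n` whose digits are all in `[L, 2 L)`. -/
def middleSet (L n : ℕ) : Set ℝ := {x | ⌊x * (3 * L : ℝ) ^ n⌋ ∈ middleInts L n}

/-- The `3 L`-adic interval of generation `n` with index `m`. -/
def adicCell (L n : ℕ) (m : ℤ) : Set ℝ := {x | ⌊x * (3 * L : ℝ) ^ n⌋ = m}

lemma adicCell_eq {L : ℕ} (hL : 0 < L) (n : ℕ) (m : ℤ) :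
    adicCell L n m = Set.Ico (m / (3 * L : ℝ) ^ n) ((m + 1) / (3 * L : ℝ) ^ n) := by
  have : (0 : ℝ) < (3 * L : ℝ) ^ n := by positivity
  ext x
  simp only [adicCell, Set.mem_ofPred_eq, Int.floor_eq_iff, Set.mem_Ico, div_le_iff₀ this,
    lt_div_iff₀ this]

lemma volume_real_adicCell {L : ℕ} (hL : 0 < L) (n : ℕ) (m : ℤ) :
    volume.real (adicCell L n m) = 1 / (3 * L : ℝ) ^ n := by
  have : (0 : ℝ) < (3 * L : ℝ) ^ n := by positivity
  rw [adicCell_eq hL, Real.volume_real_Ico_of_le (by gcongr; linarith)]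
  ring

lemma measurableSet_adicCell (L n : ℕ) (m : ℤ) : MeasurableSet (adicCell L n m) :=
  (Int.measurable_floor.comp (measurable_id.mul_const _)) (measurableSet_singleton m)

lemma measurableSet_middleSet (L n : ℕ) : MeasurableSet (middleSet L n) :=
  (Int.measurable_floor.comp (measurable_id.mul_const _)) (Finset.measurableSet _)

lemma volume_adicCell_ne_top {L : ℕ} (hL : 0 < L) (n : ℕ) (m : ℤ) :
    volume (adicCell L n m) ≠ ∞ := by
  rw [adicCell_eq hL]; simp

lemma middleSet_eq_biUnion (L n : ℕ) :
    middleSet L n = ⋃ m ∈ middleInts L n, adicCell L n m := by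
  ext x; simp [middleSet, adicCell]

lemma mem_middleSet_succ {L : ℕ} (hL : 0 < L) {n : ℕ} {x : ℝ} :
    x ∈ middleSet L (n + 1) ↔ x ∈ middleSet L n ∧
      (L : ℤ) ≤ ⌊x * (3 * L : ℝ) ^ (n + 1)⌋ % (3 * L) ∧
        ⌊x * (3 * L : ℝ) ^ (n + 1)⌋ % (3 * L) < 2 * L := by
  simp only [middleSet, Set.mem_ofPred_eq, middleInts_succ, mem_middleChildren hL,
    floor_mul_pow_ediv hL]

lemma middleSet_antitone {L : ℕ} (hL : 0 < L) : Antitone (middleSet L) :=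
  antitone_nat_of_succ_le fun _ _ hx => ((mem_middleSet_succ hL).1 hx).1

lemma floor_mem_iterate {L : ℕ} (hL : 0 < L) {p : ℕ} (n : ℕ) {x : ℝ}
    (hx : x ∈ middleSet L (p + n)) :
    ⌊x * (3 * L : ℝ) ^ (p + n)⌋ ∈ (middleChildren L)^[n] {⌊x * (3 * L : ℝ) ^ p⌋} := by
  induction n with
  | zero => simp
  | succ n ih =>
    rw [← add_assoc] at hx ⊢
    rw [mem_middleSet_succ hL] at hx
    rw [Function.iterate_succ_apply', mem_middleChildren hL, floor_mul_pow_ediv hL]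
    exact ⟨ih hx.1, hx.2⟩

/-- Each generation keeps `L` of the `3 L` children, so `n` generations shrink a cell's measure by
`3 ^ n`. -/
lemma volume_real_middleSet_inter_adicCell_le {L : ℕ} (hL : 0 < L) (p n : ℕ) (k : ℤ) :
    3 ^ n * volume.real (middleSet L (p + n) ∩ adicCell L p k) ≤ 1 / (3 * L : ℝ) ^ p := by
  have hsub : middleSet L (p + n) ∩ adicCell L p k ⊆
      ⋃ m ∈ (middleChildren L)^[n] {k}, adicCell L (p + n) m := by
    rintro x ⟨h1, h2⟩
    have := floor_mem_iterate hL n h1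
    rw [show ⌊x * (3 * L : ℝ) ^ p⌋ = k from h2] at this
    simpa [adicCell] using this
  have h1 : volume.real (middleSet L (p + n) ∩ adicCell L p k) ≤
      ∑ m ∈ (middleChildren L)^[n] {k}, volume.real (adicCell L (p + n) m) := by
    refine (measureReal_mono hsub ?_).trans (measureReal_biUnion_finset_le _ _)
    exact (measure_biUnion_lt_top (Finset.finite_toSet _)
      fun m _ => (volume_adicCell_ne_top hL _ m).lt_top).ne
  simp only [volume_real_adicCell hL, Finset.sum_const, card_iterate_middleChildren,
    nsmul_eq_mul] at h1
  calc _ ≤ (3 : ℝ) ^ n * (((L ^ n : ℕ) : ℝ) * (1 / (3 * L : ℝ) ^ (p + n))) := by gcongr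
    _ = _ := by
      have : (L : ℝ) ≠ 0 := by positivity
      push_cast
      rw [pow_add, mul_pow (3 : ℝ) _ n]
      field_simp

/-- The point `y` is in the middle third of the cell, so a third of the cell separates it from
either end. The interval joins `y` to a point beyond one of the ends and covers that third. -/
lemma volume_real_Icc_inter_adicCell_ge {L : ℕ} (hL : 0 < L) {p : ℕ} {k : ℤ} {a b x y : ℝ}
    (hx : x ∈ Set.Icc a b) (hxk : x ∉ adicCell L p k) (hy : y ∈ Set.Icc a b)
    (hyk : y ∈ adicCell L p k) (hyp : y ∈ middleSet L (p + 1)) :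
    1 / (3 * L : ℝ) ^ p ≤ 3 * volume.real (Set.Icc a b ∩ adicCell L p k) := by
  have hB : (0 : ℝ) < (3 * L : ℝ) ^ p := by positivity
  have hL' : (0 : ℝ) < L := by positivity
  obtain ⟨-, h1, h2⟩ := (mem_middleSet_succ hL).1 hyp
  have hdiv := floor_mul_pow_ediv hL y p
  rw [show ⌊y * (3 * L : ℝ) ^ p⌋ = k from hyk] at hdiv
  have hem := Int.emod_add_mul_ediv ⌊y * (3 * L : ℝ) ^ (p + 1)⌋ (3 * L)
  rw [hdiv] at hem
  have hlo : (3 * L * k + L : ℤ) ≤ ⌊y * (3 * L : ℝ) ^ (p + 1)⌋ := by linarith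
  have hhi : ⌊y * (3 * L : ℝ) ^ (p + 1)⌋ < (3 * L * k + 2 * L : ℤ) := by linarith
  rw [Int.le_floor] at hlo
  rw [Int.floor_lt] at hhi
  push_cast at hlo hhi
  have hlo' : k / (3 * L : ℝ) ^ p + 1 / 3 / (3 * L : ℝ) ^ p ≤ y := by
    rw [← add_div, div_le_iff₀ hB]
    rw [pow_succ] at hlo
    nlinarith
  have hhi' : y ≤ (k + 1) / (3 * L : ℝ) ^ p - 1 / 3 / (3 * L : ℝ) ^ p := by
    rw [← sub_div, le_div_iff₀ hB]
    rw [pow_succ] at hhi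
    nlinarith
  rw [adicCell_eq hL] at hxk ⊢
  simp only [Set.mem_Ico, not_and_or, not_le, not_lt] at hxk
  have hpos : 0 < 1 / 3 / (3 * L : ℝ) ^ p := by positivity
  have hfin : volume (Set.Icc a b ∩ Set.Ico (k / (3 * L : ℝ) ^ p) ((k + 1) / (3 * L : ℝ) ^ p))
      ≠ ∞ := measure_ne_top_of_subset Set.inter_subset_left (by simp)
  have key : 1 / 3 / (3 * L : ℝ) ^ p ≤
      volume.real (Set.Icc a b ∩ Set.Ico (k / (3 * L : ℝ) ^ p) ((k + 1) / (3 * L : ℝ) ^ p)) := by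
    rcases hxk with h | h
    · have hsub : Set.Icc (k / (3 * L : ℝ) ^ p) y ⊆
          Set.Icc a b ∩ Set.Ico (k / (3 * L : ℝ) ^ p) ((k + 1) / (3 * L : ℝ) ^ p) :=
        fun z hz => ⟨⟨by linarith [hx.1, hz.1], by linarith [hy.2, hz.2]⟩, hz.1,
          by linarith [hz.2]⟩
      refine le_trans ?_ (measureReal_mono hsub hfin)
      rw [Real.volume_real_Icc_of_le (by linarith)]
      linarith
    · have hsub : Set.Ico y ((k + 1) / (3 * L : ℝ) ^ p) ⊆
          Set.Icc a b ∩ Set.Ico (k / (3 * L : ℝ) ^ p) ((k + 1) / (3 * L : ℝ) ^ p) :=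
        fun z hz => ⟨⟨by linarith [hy.1, hz.1], by linarith [hx.2, hz.2]⟩,
          by linarith [hz.1], hz.2⟩
      refine le_trans ?_ (measureReal_mono hsub hfin)
      rw [Real.volume_real_Ico_of_le (by linarith)]
      linarith
  calc 1 / (3 * L : ℝ) ^ p = 3 * (1 / 3 / (3 * L : ℝ) ^ p) := by ring
    _ ≤ _ := by gcongr

/-- An interval that leaves the generation `p` meets the later generations in little mass. -/
lemma volume_real_middleSet_inter_Icc_le {L : ℕ} (hL : 0 < L) {p : ℕ} (m : ℕ) {a b x : ℝ}
    (hx : x ∈ Set.Icc a b) (hxp : x ∉ middleSet L p) :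
    3 ^ m * volume.real (middleSet L m ∩ Set.Icc a b) ≤ 3 ^ (p + 1) * (b - a) := by
  have hab : a ≤ b := hx.1.trans hx.2
  have hQ : volume.real (Set.Icc a b) = b - a := Real.volume_real_Icc_of_le hab
  rcases le_or_gt m p with hmp | hmp
  · have : volume.real (middleSet L m ∩ Set.Icc a b) ≤ b - a :=
      hQ ▸ measureReal_mono Set.inter_subset_right (by simp)
    have h3 : (3 : ℝ) ^ m ≤ 3 ^ (p + 1) := pow_le_pow_right₀ (by norm_num) (by omega)
    gcongr
  obtain ⟨n, rfl⟩ : ∃ n, m = p + (n + 1) := ⟨m - p - 1, by omega⟩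
  -- In each cell the later generation has a fixed fraction of the cell's length, and that length is
  -- at most three times what the interval covers. The loss of 3 is the extra factor in `3 ^ (p +
  -- 1)`.
  have hcell : ∀ k ∈ middleInts L p,
      3 ^ (n + 1) * volume.real (middleSet L (p + (n + 1)) ∩ adicCell L p k ∩ Set.Icc a b) ≤
        3 * volume.real (Set.Icc a b ∩ adicCell L p k) := by
    intro k hk
    rcases Set.eq_empty_or_nonempty (middleSet L (p + (n + 1)) ∩ adicCell L p k ∩ Set.Icc a b)
      with he | ⟨y, ⟨hy1, hy2⟩, hy3⟩
    · rw [he]; simp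
    · have hxk : x ∉ adicCell L p k := fun h => hxp (by
        rw [middleSet, Set.mem_ofPred_eq, show ⌊x * (3 * L : ℝ) ^ p⌋ = k from h]; exact hk)
      refine le_trans ?_ (volume_real_Icc_inter_adicCell_ge hL hx hxk hy3 hy2
        (middleSet_antitone hL (by omega) hy1))
      refine le_trans ?_ (volume_real_middleSet_inter_adicCell_le hL p (n + 1) k)
      exact mul_le_mul_of_nonneg_left (measureReal_mono Set.inter_subset_left
        (measure_ne_top_of_subset Set.inter_subset_right (volume_adicCell_ne_top hL p k)))
        (by positivity)
  have hsub : middleSet L (p + (n + 1)) ∩ Set.Icc a b ⊆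
      ⋃ k ∈ middleInts L p, middleSet L (p + (n + 1)) ∩ adicCell L p k ∩ Set.Icc a b := by
    rintro y ⟨h1, h2⟩
    have : y ∈ middleSet L p := middleSet_antitone hL (by omega) h1
    rw [middleSet_eq_biUnion] at this
    simp only [Set.mem_iUnion] at this ⊢
    obtain ⟨k, hk, hy⟩ := this
    exact ⟨k, hk, ⟨h1, hy⟩, h2⟩
  have h1 : volume.real (middleSet L (p + (n + 1)) ∩ Set.Icc a b) ≤ ∑ k ∈ middleInts L p,
      volume.real (middleSet L (p + (n + 1)) ∩ adicCell L p k ∩ Set.Icc a b) := by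
    refine (measureReal_mono hsub ?_).trans (measureReal_biUnion_finset_le _ _)
    exact (measure_biUnion_lt_top (Finset.finite_toSet _) fun k _ =>
      (measure_mono Set.inter_subset_right).trans_lt (by simp)).ne
  have h2 : ∑ k ∈ middleInts L p, volume.real (Set.Icc a b ∩ adicCell L p k) ≤ b - a := by
    rw [← hQ, ← measureReal_biUnion_finset ?_ ?_ ?_]
    · exact measureReal_mono (by simp) (by simp)
    · intro i _ j _ hij
      refine Set.disjoint_left.2 fun z hi hj => hij ?_
      exact (show ⌊z * (3 * L : ℝ) ^ p⌋ = i from hi.2).symm.trans hj.2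
    · exact fun k _ => measurableSet_Icc.inter (measurableSet_adicCell L p k)
    · exact fun k _ => measure_ne_top_of_subset Set.inter_subset_left (by simp)
  calc _ ≤ (3 : ℝ) ^ (p + (n + 1)) * ∑ k ∈ middleInts L p,
        volume.real (middleSet L (p + (n + 1)) ∩ adicCell L p k ∩ Set.Icc a b) := by gcongr
    _ = 3 ^ p * ∑ k ∈ middleInts L p, 3 ^ (n + 1) *
        volume.real (middleSet L (p + (n + 1)) ∩ adicCell L p k ∩ Set.Icc a b) := by
      rw [← Finset.mul_sum, pow_add]; ring
    _ ≤ 3 ^ p * ∑ k ∈ middleInts L p, 3 * volume.real (Set.Icc a b ∩ adicCell L p k) := by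
      exact mul_le_mul_of_nonneg_left (Finset.sum_le_sum hcell) (by positivity)
    _ = 3 ^ (p + 1) * ∑ k ∈ middleInts L p, volume.real (Set.Icc a b ∩ adicCell L p k) := by
      rw [← Finset.mul_sum, pow_succ]; ring
    _ ≤ _ := by gcongr

/-! ### ### The weight and its `A_1` constant -/

/-- The weight which is comparable to `3 ^ n / L` on the `n`-th difference of the nested sets
`middleSet L n`, `n < L`, and to `3 ^ L` on `middleSet L L`. -/
noncomputable def nestedWeight (L : ℕ) (x : ℝ) : ℝ :=
  (1 / L) * (1 + ∑ n ∈ Finset.range L, 3 ^ n * (middleSet L n).indicator 1 x) +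
    3 ^ L * (middleSet L L).indicator 1 x

lemma indicator_one_nonneg (s : Set ℝ) (x : ℝ) : 0 ≤ s.indicator (1 : ℝ → ℝ) x :=
  Set.indicator_nonneg (fun _ _ => zero_le_one) x

lemma indicator_one_le (s : Set ℝ) (x : ℝ) : s.indicator (1 : ℝ → ℝ) x ≤ 1 :=
  Set.indicator_le_self' (fun _ _ => zero_le_one) x

lemma one_add_sum_three_pow (p : ℕ) :
    1 + ∑ n ∈ Finset.range p, (3 : ℝ) ^ n = (3 ^ p + 1) / 2 := by
  rw [geom_sum_eq (by norm_num)]; ring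

lemma nestedWeight_nonneg (L : ℕ) (x : ℝ) : 0 ≤ nestedWeight L x := by
  have := fun n => indicator_one_nonneg (middleSet L n) x
  unfold nestedWeight
  have h2 : 0 ≤ ∑ n ∈ Finset.range L, (3 : ℝ) ^ n * (middleSet L n).indicator 1 x :=
    Finset.sum_nonneg fun n _ => mul_nonneg (by positivity) (this n)
  have h3 := this L
  positivity

lemma measurable_nestedWeight (L : ℕ) : Measurable (nestedWeight L) := by
  have := fun n => (measurable_one (α := ℝ) (β := ℝ)).indicator (measurableSet_middleSet L n)
  unfold nestedWeight
  fun_prop (disch := assumption)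

lemma nestedWeight_le {L p : ℕ} (hL : 0 < L) (hp : p ≤ L) {x : ℝ} (hx : x ∉ middleSet L p) :
    nestedWeight L x ≤ 3 ^ p / L := by
  have hzero : ∀ n, p ≤ n → (middleSet L n).indicator (1 : ℝ → ℝ) x = 0 := fun n hn =>
    Set.indicator_of_notMem (fun h => hx (middleSet_antitone hL hn h)) _
  have hsum : ∑ n ∈ Finset.range L, (3 : ℝ) ^ n * (middleSet L n).indicator 1 x ≤
      ∑ n ∈ Finset.range p, (3 : ℝ) ^ n := by
    rw [← Finset.sum_subset (Finset.range_mono hp)]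
    · exact Finset.sum_le_sum fun n _ =>
        mul_le_of_le_one_right (by positivity) (indicator_one_le _ _)
    · intro n _ hn
      rw [hzero n (by simpa using hn), mul_zero]
  have h3 := one_add_sum_three_pow p
  have h1 : (1 : ℝ) ≤ 3 ^ p := one_le_pow₀ (by norm_num)
  rw [nestedWeight, hzero L hp, mul_zero, add_zero, one_div_mul_eq_div]
  gcongr
  linarith

lemma nestedWeight_le_top {L : ℕ} (hL : 0 < L) (x : ℝ) : nestedWeight L x ≤ 2 * 3 ^ L := by
  have hsum : ∑ n ∈ Finset.range L, (3 : ℝ) ^ n * (middleSet L n).indicator 1 x ≤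
      ∑ n ∈ Finset.range L, (3 : ℝ) ^ n :=
    Finset.sum_le_sum fun n _ => mul_le_of_le_one_right (by positivity) (indicator_one_le _ _)
  have h3 := one_add_sum_three_pow L
  have h1 : (1 : ℝ) ≤ 3 ^ L := one_le_pow₀ (by norm_num)
  have hL1 : (1 : ℝ) ≤ L := by exact_mod_cast hL
  have h4 : (1 / L : ℝ) * (1 + ∑ n ∈ Finset.range L, 3 ^ n * (middleSet L n).indicator 1 x) ≤
      1 * 3 ^ L := by
    have h6 : 0 ≤ ∑ n ∈ Finset.range L, (3 : ℝ) ^ n * (middleSet L n).indicator 1 x :=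
      Finset.sum_nonneg fun n _ => mul_nonneg (by positivity) (indicator_one_nonneg _ _)
    refine mul_le_mul ?_ (by linarith) (by positivity) zero_le_one
    rwa [div_le_one (by positivity)]
  have h5 : (3 : ℝ) ^ L * (middleSet L L).indicator 1 x ≤ 3 ^ L :=
    mul_le_of_le_one_right (by positivity) (indicator_one_le _ _)
  rw [nestedWeight]
  linarith

lemma le_nestedWeight {L p : ℕ} (hL : 0 < L) (hp : p ≤ L) {x : ℝ}
    (hx : ∀ n < p, x ∈ middleSet L n) : 3 ^ p / (2 * L) ≤ nestedWeight L x := by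
  have hL' : (0 : ℝ) < L := by positivity
  have hsum : ∑ n ∈ Finset.range p, (3 : ℝ) ^ n ≤
      ∑ n ∈ Finset.range L, (3 : ℝ) ^ n * (middleSet L n).indicator 1 x := by
    rw [Finset.sum_congr rfl (fun n hn => show (3 : ℝ) ^ n =
      3 ^ n * (middleSet L n).indicator 1 x by
        rw [Set.indicator_of_mem (hx n (Finset.mem_range.1 hn))]; simp)]
    exact Finset.sum_le_sum_of_subset_of_nonneg (Finset.range_mono hp) fun n _ _ =>
      mul_nonneg (by positivity) (indicator_one_nonneg _ _)
  have h3 := one_add_sum_three_pow p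
  have h5 : 0 ≤ (3 : ℝ) ^ L * (middleSet L L).indicator 1 x :=
    mul_nonneg (by positivity) (indicator_one_nonneg _ _)
  rw [nestedWeight]
  calc (3 : ℝ) ^ p / (2 * L) = (1 / L) * (3 ^ p / 2) := by field_simp
    _ ≤ (1 / L) * (1 + ∑ n ∈ Finset.range L, (3 : ℝ) ^ n * (middleSet L n).indicator 1 x) := by
      gcongr; linarith
    _ ≤ _ := by linarith

lemma le_nestedWeight_of_mem {L : ℕ} {x : ℝ} (hx : x ∈ middleSet L L) :
    3 ^ L ≤ nestedWeight L x := by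
  have h2 : 0 ≤ ∑ n ∈ Finset.range L, (3 : ℝ) ^ n * (middleSet L n).indicator 1 x :=
    Finset.sum_nonneg fun n _ => mul_nonneg (by positivity) (indicator_one_nonneg _ _)
  rw [nestedWeight, Set.indicator_of_mem hx, Pi.one_apply, mul_one]
  have : (0 : ℝ) ≤ (1 / L) *
    (1 + ∑ n ∈ Finset.range L, (3 : ℝ) ^ n * (middleSet L n).indicator 1 x) := by positivity
  linarith

lemma isWeight_nestedWeight {L : ℕ} (hL : 0 < L) : IsWeight (nestedWeight L) where
  nonneg := nestedWeight_nonneg L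
  locallyIntegrable := by
    refine (locallyIntegrable_const (2 * 3 ^ L : ℝ)).mono
      (measurable_nestedWeight L).aestronglyMeasurable (ae_of_all _ fun x => ?_)
    rw [Real.norm_of_nonneg (nestedWeight_nonneg L x), Real.norm_of_nonneg (by positivity)]
    exact nestedWeight_le_top hL x

lemma setIntegral_indicator_one {s : Set ℝ} (hs : MeasurableSet s) (a b : ℝ) :
    ∫ y in Set.Icc a b, s.indicator (1 : ℝ → ℝ) y = volume.real (s ∩ Set.Icc a b) := by
  rw [integral_indicator_one hs, measureReal_restrict_apply hs]

lemma setIntegral_nestedWeight {L : ℕ} (a b : ℝ) :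
    ∫ y in Set.Icc a b, nestedWeight L y =
      (1 / L) * (volume.real (Set.Icc a b) +
        ∑ n ∈ Finset.range L, 3 ^ n * volume.real (middleSet L n ∩ Set.Icc a b)) +
      3 ^ L * volume.real (middleSet L L ∩ Set.Icc a b) := by
  have hi : ∀ n, Integrable ((middleSet L n).indicator (1 : ℝ → ℝ))
      (volume.restrict (Set.Icc a b)) := fun n =>
    (integrable_const (1 : ℝ)).indicator (measurableSet_middleSet L n)
  have hs : Integrable (fun y => ∑ n ∈ Finset.range L,
      (3 : ℝ) ^ n * (middleSet L n).indicator 1 y) (volume.restrict (Set.Icc a b)) :=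
    integrable_finsetSum _ fun n _ => (hi n).const_mul _
  have hs' : Integrable (fun y => (1 / L : ℝ) * (1 + ∑ n ∈ Finset.range L,
      (3 : ℝ) ^ n * (middleSet L n).indicator 1 y)) (volume.restrict (Set.Icc a b)) :=
    ((integrable_const 1).add hs).const_mul _
  unfold nestedWeight
  rw [integral_add hs' ((hi L).const_mul _),
    integral_const_mul, integral_const_mul, integral_add (integrable_const _) hs,
    integral_finsetSum _ fun n _ => (hi n).const_mul _]
  simp only [integral_const_mul, setIntegral_indicator_one (measurableSet_middleSet L _)]
  simp

/-- Every generation has mass at most `3 ^ (p + 1) * (b - a)`. The `L` generations carrying the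
factor `1 / L` together count as one, and the top term as one more, so no power of `L` is lost. -/
lemma setIntegral_nestedWeight_le {L p : ℕ} (hL : 0 < L) {a b x : ℝ}
    (hx : x ∈ Set.Icc a b) (hxp : x ∉ middleSet L p) :
    ∫ y in Set.Icc a b, nestedWeight L y ≤ 9 * 3 ^ p * (b - a) := by
  have hab : a ≤ b := hx.1.trans hx.2
  have hL' : (1 : ℝ) ≤ L := by exact_mod_cast hL
  have key := fun m => volume_real_middleSet_inter_Icc_le hL m hx hxp
  have h0 : 0 ≤ b - a := by linarith
  have h1 : (1 : ℝ) ≤ 3 ^ p := one_le_pow₀ (by norm_num)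
  rw [setIntegral_nestedWeight, Real.volume_real_Icc_of_le hab]
  have hs : ∑ n ∈ Finset.range L, 3 ^ n * volume.real (middleSet L n ∩ Set.Icc a b) ≤
      L * (3 ^ (p + 1) * (b - a)) :=
    (Finset.sum_le_sum fun n _ => key n).trans (by simp)
  calc _ ≤ (1 / L : ℝ) * (L * (b - a) + L * (3 ^ (p + 1) * (b - a))) +
        3 ^ (p + 1) * (b - a) := by
        refine add_le_add ?_ (key L)
        gcongr
        exact le_mul_of_one_le_left h0 hL'
    _ = (1 + 6 * 3 ^ p) * (b - a) := by
        field_simp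
        ring
    _ ≤ _ := by gcongr; linarith

lemma lintegral_enorm_nestedWeight {L : ℕ} (hL : 0 < L) (a b : ℝ) :
    ∫⁻ y in Set.Icc a b, ‖nestedWeight L y‖ₑ =
      ENNReal.ofReal (∫ y in Set.Icc a b, nestedWeight L y) := by
  rw [ofReal_integral_eq_lintegral_ofReal
    (((isWeight_nestedWeight hL).locallyIntegrable.integrableOn_isCompact isCompact_Icc))
    (ae_of_all _ (nestedWeight_nonneg L))]
  simp only [Real.enorm_eq_ofReal (nestedWeight_nonneg L _)]

lemma hlMaximal_nestedWeight_le {L : ℕ} (hL : 0 < L) {x A : ℝ}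
    (h : ∀ a b, a < b → x ∈ Set.Icc a b → ∫ y in Set.Icc a b, nestedWeight L y ≤ A * (b - a)) :
    hlMaximal (nestedWeight L) x ≤ ENNReal.ofReal A := by
  refine iSup_le fun a => iSup_le fun b => iSup_le fun hab => iSup_le fun hx => ?_
  rw [lintegral_enorm_nestedWeight hL, ← ENNReal.ofReal_div_of_pos (by linarith)]
  refine ENNReal.ofReal_le_ofReal ?_
  rw [div_le_iff₀ (by linarith)]
  exact h a b hab hx

lemma a1Const_nestedWeight_le {L : ℕ} (hL : 0 < L) :
    a1Const (nestedWeight L) ≤ ENNReal.ofReal (18 * L) := by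
  have hL' : (1 : ℝ) ≤ L := by exact_mod_cast hL
  have hmain : ∀ x A, 0 < nestedWeight L x → hlMaximal (nestedWeight L) x ≤ ENNReal.ofReal A →
      A ≤ 18 * L * nestedWeight L x →
      hlMaximal (nestedWeight L) x / ENNReal.ofReal (nestedWeight L x) ≤
        ENNReal.ofReal (18 * L) := by
    intro x A hpos hM hA
    refine ENNReal.div_le_of_le_mul ?_
    rw [← ENNReal.ofReal_mul (by positivity)]
    exact hM.trans (ENNReal.ofReal_le_ofReal hA)
  refine essSup_le_of_ae_le _ (ae_of_all _ fun x => ?_)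
  -- On the innermost set the weight is within a factor 2 of its supremum; the factor `L` is lost
  -- only outside it.
  by_cases hx : x ∈ middleSet L L
  · have h3 := le_nestedWeight_of_mem hx
    have hp : (0 : ℝ) < 3 ^ L := by positivity
    refine hmain x (2 * 3 ^ L) (hp.trans_le h3) (hlMaximal_nestedWeight_le hL ?_) ?_
    · intro a b hab _
      calc _ ≤ ∫ y in Set.Icc a b, (2 * 3 ^ L : ℝ) :=
            integral_mono ((isWeight_nestedWeight hL).locallyIntegrable.integrableOn_isCompact
              isCompact_Icc) (integrable_const _) (nestedWeight_le_top hL)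
        _ = _ := by
            simp [Real.volume_real_Icc_of_le hab.le, mul_comm]
    · nlinarith
  · classical
    -- The first generation that misses `x` fixes both sides: averages are at most `9 * 3 ^ p`, and
    -- the weight at `x` is at least `3 ^ p / (2 * L)`.
    have hex : ∃ p, x ∉ middleSet L p := ⟨L, hx⟩
    have hpL : Nat.find hex ≤ L := Nat.find_le hx
    have hge := le_nestedWeight hL hpL (x := x) fun n hn => not_not.1 (Nat.find_min hex hn)
    have hp : (0 : ℝ) < 3 ^ Nat.find hex / (2 * L) := by positivity
    refine hmain x (9 * 3 ^ Nat.find hex) (hp.trans_le hge) (hlMaximal_nestedWeight_le hL ?_) ?_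
    · exact fun a b _ hxab => setIntegral_nestedWeight_le hL hxab (Nat.find_spec hex)
    · calc (9 : ℝ) * 3 ^ Nat.find hex = 18 * L * (3 ^ Nat.find hex / (2 * L)) := by
            field_simp; ring
        _ ≤ _ := by gcongr

/-! ### Distribution of the digits -/

/-- The sum of `1 / (j + 2)` over the last `n` digits `L + j` of an integer in base `3 L`. -/
noncomputable def digitSum (L : ℕ) : ℕ → ℤ → ℝ
  | 0, _ => 0
  | n + 1, y => digitSum L n (y / (3 * L)) + 1 / (((y % (3 * L) - L : ℤ) : ℝ) + 2)

/-- The sum of `1 / (j + 2)` over all the `j < L`. -/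
noncomputable def shiftedHarmonic (L : ℕ) : ℝ := ∑ j ∈ Finset.range L, 1 / ((j : ℝ) + 2)

lemma digitSum_middleChild {L j : ℕ} (hj : j < L) (n : ℕ) (m : ℤ) :
    digitSum L (n + 1) (3 * L * m + L + j) = digitSum L n m + 1 / ((j : ℝ) + 2) := by
  rw [digitSum, ediv_middleChild hj, emod_middleChild hj]
  simp

lemma digitSum_floor {L : ℕ} (hL : 0 < L) (x : ℝ) (n : ℕ) :
    digitSum L n ⌊x * (3 * L : ℝ) ^ n⌋ = ∑ i ∈ Finset.range n,
      1 / (((⌊x * (3 * L : ℝ) ^ (i + 1)⌋ % (3 * L) - L : ℤ) : ℝ) + 2) := by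
  induction n with
  | zero => simp [digitSum]
  | succ n ih => rw [digitSum, floor_mul_pow_ediv hL, ih, Finset.sum_range_succ]

lemma shiftedHarmonic_ge (L : ℕ) : Real.log L - 1 ≤ shiftedHarmonic L := by
  have h := log_add_one_le_harmonic (L + 1)
  have h2 : ((harmonic (L + 1) : ℚ) : ℝ) = shiftedHarmonic L + 1 := by
    rw [harmonic, Finset.sum_range_succ', shiftedHarmonic]
    push_cast
    congr 1
    · refine Finset.sum_congr rfl fun j _ => ?_
      rw [one_div]; congr 1; ring
    · simp
  rcases Nat.eq_zero_or_pos L with rfl | hL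
  · simp [shiftedHarmonic]
  have h3 : Real.log L ≤ Real.log ((L + 1 + 1 : ℕ) : ℝ) :=
    Real.log_le_log (by positivity) (by push_cast; linarith)
  linarith

/-- A variance bound for one digit, scaled by `L`: the second moment is at most the first because `1
/ (j + 2) ≤ 1`. -/
lemma sum_sq_digit_le (L : ℕ) : ∑ j ∈ Finset.range L,
    ((L : ℝ) * (1 / ((j : ℝ) + 2)) - shiftedHarmonic L) ^ 2 ≤ L ^ 2 * shiftedHarmonic L := by
  have h1 : ∀ j : ℕ, ((L : ℝ) * (1 / ((j : ℝ) + 2)) - shiftedHarmonic L) ^ 2 =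
      L ^ 2 * (1 / ((j : ℝ) + 2)) ^ 2 - 2 * L * shiftedHarmonic L * (1 / ((j : ℝ) + 2)) +
        shiftedHarmonic L ^ 2 := fun j => by ring
  have h2 : ∑ j ∈ Finset.range L, (1 / ((j : ℝ) + 2)) ^ 2 ≤ shiftedHarmonic L := by
    refine Finset.sum_le_sum fun j _ => ?_
    have h : 1 / ((j : ℝ) + 2) ≤ 1 := by rw [div_le_one (by positivity)]; linarith
    exact pow_le_of_le_one (by positivity) h two_ne_zero
  simp only [h1, Finset.sum_add_distrib, Finset.sum_sub_distrib, ← Finset.mul_sum,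
    Finset.sum_const, Finset.card_range, nsmul_eq_mul]
  rw [show ∑ j ∈ Finset.range L, 1 / ((j : ℝ) + 2) = shiftedHarmonic L from rfl]
  have h3 : 0 ≤ L * shiftedHarmonic L ^ 2 := by positivity
  nlinarith [mul_le_mul_of_nonneg_left h2 (sq_nonneg (L : ℝ))]

lemma sum_digit_sub (L : ℕ) : ∑ j ∈ Finset.range L,
    ((L : ℝ) * (1 / ((j : ℝ) + 2)) - shiftedHarmonic L) = 0 := by
  simp only [Finset.sum_sub_distrib, ← Finset.mul_sum, Finset.sum_const, Finset.card_range,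
    nsmul_eq_mul]
  rw [show ∑ j ∈ Finset.range L, 1 / ((j : ℝ) + 2) = shiftedHarmonic L from rfl, sub_self]

lemma card_middleInts (L n : ℕ) : (middleInts L n).card = L ^ n :=
  card_iterate_middleChildren L n 0

/-- Variances of independent digits add: in the induction the cross term vanishes by
`sum_digit_sub`, and each new digit costs what `sum_sq_digit_le` allows. -/
lemma sum_sq_digitSum_le (L n : ℕ) : ∑ y ∈ middleInts L n,
    ((L : ℝ) * digitSum L n y - n * shiftedHarmonic L) ^ 2 ≤
      n * (L : ℝ) ^ (n + 1) * shiftedHarmonic L := by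
  induction n with
  | zero => simp [digitSum]
  | succ n ih =>
    have h1 : ∀ m, ∑ j ∈ Finset.range L, ((L : ℝ) * digitSum L (n + 1) (3 * L * m + L + j) -
        (n + 1 : ℕ) * shiftedHarmonic L) ^ 2 ≤
          L * ((L : ℝ) * digitSum L n m - n * shiftedHarmonic L) ^ 2 +
            L ^ 2 * shiftedHarmonic L := by
      intro m
      rw [Finset.sum_congr rfl fun (j : ℕ) (hj : j ∈ Finset.range L) => show ((L : ℝ) *
        digitSum L (n + 1) (3 * L * m + L + j) - (n + 1 : ℕ) * shiftedHarmonic L) ^ 2 =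
        ((L : ℝ) * digitSum L n m - n * shiftedHarmonic L) ^ 2 +
        2 * ((L : ℝ) * digitSum L n m - n * shiftedHarmonic L) *
          ((L : ℝ) * (1 / ((j : ℝ) + 2)) - shiftedHarmonic L) +
        ((L : ℝ) * (1 / ((j : ℝ) + 2)) - shiftedHarmonic L) ^ 2 by
          rw [digitSum_middleChild (Finset.mem_range.1 hj)]; push_cast; ring]
      rw [Finset.sum_add_distrib, Finset.sum_add_distrib, ← Finset.mul_sum, sum_digit_sub]
      have := sum_sq_digit_le L
      simp only [Finset.sum_const, Finset.card_range, nsmul_eq_mul]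
      linarith
    rw [middleInts_succ, sum_middleChildren]
    refine (Finset.sum_le_sum fun m _ => h1 m).trans ?_
    rw [Finset.sum_add_distrib, ← Finset.mul_sum, Finset.sum_const, card_middleInts,
      nsmul_eq_mul]
    have := mul_le_mul_of_nonneg_left ih (Nat.cast_nonneg (α := ℝ) L)
    push_cast
    calc _ ≤ (L : ℝ) * (n * (L : ℝ) ^ (n + 1) * shiftedHarmonic L) +
          (L : ℝ) ^ n * (L ^ 2 * shiftedHarmonic L) := by gcongr
      _ = _ := by ring

/-- Most of the integers of generation `L` have a large digit sum. -/
lemma card_large_digitSum {L : ℕ} (hH : 8 ≤ shiftedHarmonic L) :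
    (L : ℝ) ^ L / 2 ≤ ((middleInts L L).filter
      fun y => shiftedHarmonic L / 2 ≤ digitSum L L y).card := by
  set H := shiftedHarmonic L
  have hL : 0 < L := by
    rcases Nat.eq_zero_or_pos L with h | h
    · subst h; simp [H, shiftedHarmonic] at hH; norm_num at hH
    · exact h
  have hL' : (0 : ℝ) < L := by exact_mod_cast hL
  have hcard := Finset.card_filter_add_card_filter_not (s := middleInts L L)
    (fun y => H / 2 ≤ digitSum L L y)
  rw [card_middleInts] at hcard
  have hcard' : ((((middleInts L L).filter fun y => H / 2 ≤ digitSum L L y).card : ℝ)) +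
      ((middleInts L L).filter fun y => ¬ H / 2 ≤ digitSum L L y).card = (L : ℝ) ^ L := by
    exact_mod_cast hcard
  set bad := (middleInts L L).filter fun y => ¬ H / 2 ≤ digitSum L L y
  -- Chebyshev's inequality: a bad integer deviates from the mean by at least `L * H / 2` in the
  -- scaled variable.
  have h1 : (bad.card : ℝ) * ((L * H / 2) ^ 2) ≤ L * (L : ℝ) ^ (L + 1) * H := by
    refine le_trans ?_ (sum_sq_digitSum_le L L)
    refine le_trans ?_ (Finset.sum_le_sum_of_subset_of_nonneg (Finset.filter_subset
      (fun y => ¬ H / 2 ≤ digitSum L L y) _) fun _ _ _ => sq_nonneg _)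
    rw [← nsmul_eq_mul]
    refine Finset.card_nsmul_le_sum _ _ _ fun y hy => ?_
    have hy2 := (Finset.mem_filter.1 hy).2
    rw [not_le] at hy2
    have h3 : L * digitSum L L y ≤ L * (H / 2) := by gcongr
    have h4 : 0 ≤ L * H / 2 := by positivity
    rw [← neg_sq (L * digitSum L L y - _)]
    gcongr
    linarith
  have h2 : (bad.card : ℝ) * H ≤ 4 * (L : ℝ) ^ L := by
    have hpos : 0 < (L : ℝ) ^ 2 * H / 4 := by positivity
    refine le_of_mul_le_mul_right ?_ hpos
    calc _ = (bad.card : ℝ) * ((L * H / 2) ^ 2) := by ring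
      _ ≤ _ := h1
      _ = _ := by ring
  have h5 : (bad.card : ℝ) * 8 ≤ bad.card * H := by gcongr
  linarith

/-! ### The Hilbert transform off the support -/

/-- Truncations smaller than the gap between `x` and the support of `f` remove nothing, so they all
equal the full integral. -/
lemma hilbertTransform_eq_integral {f : ℝ → ℝ} {x : ℝ} (hf : Integrable f)
    (h0 : ∀ᶠ y in 𝓝 x, f y = 0) : hilbertTransform f x = ∫ y, f y / (x - y) := by
  have hpv : HasHilbertPV f x (∫ y, f y / (x - y)) := by
    have hm : ∀ ε : ℝ, MeasurableSet {y | ε < |x - y|} := fun ε =>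
      measurableSet_lt measurable_const (by fun_prop)
    constructor
    · intro ε hε
      refine Integrable.mono' (g := fun y => ε⁻¹ * ‖f y‖) (hf.norm.const_mul _).integrableOn
        ((hf.aestronglyMeasurable.restrict).div₀ (by fun_prop)) ?_
      refine (ae_restrict_iff' (hm ε)).2 (ae_of_all _ fun y hy => ?_)
      rw [norm_div, div_eq_inv_mul, Real.norm_eq_abs (x - y)]
      gcongr
      exact hy.le
    · obtain ⟨δ, hδ, hball⟩ := Metric.eventually_nhds_iff.1 h0
      refine tendsto_const_nhds.congr' ?_
      filter_upwards [Ioo_mem_nhdsGT hδ] with ε hε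
      symm
      refine setIntegral_eq_integral_of_forall_compl_eq_zero fun y hy => ?_
      rw [hball, zero_div]
      rw [Real.dist_eq, abs_sub_comm]
      simp only [Set.mem_ofPred_eq, not_lt] at hy
      exact hy.trans_lt hε.2
  have hex : ∃ L, HasHilbertPV f x L := ⟨_, hpv⟩
  rw [hilbertTransform, dif_pos hex]
  exact tendsto_nhds_unique hex.choose_spec.2 hpv.2

lemma lt_or_lt_of_notMem_Icc {α β x : ℝ} (hx : x ∉ Set.Icc α β) : β < x ∨ x < α := by
  by_contra! h
  exact hx ⟨h.2, h.1⟩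

lemma integrableOn_one_div_sub {α β x : ℝ} (hx : x ∉ Set.Icc α β) :
    IntegrableOn (fun y => 1 / (x - y)) (Set.Ico α β) := by
  refine (ContinuousOn.integrableOn_compact isCompact_Icc ?_).mono_set Set.Ico_subset_Icc_self
  refine continuousOn_const.div (by fun_prop) fun y hy h => hx ?_
  rwa [sub_eq_zero.1 h]

/-- The kernel `1 / (x - y)` increases in `y` on each side of `x`, so its endpoint values bound it,
whichever side the interval is on. -/
lemma setIntegral_one_div_sub_bounds {α β x : ℝ} (hαβ : α < β) (hx : x ∉ Set.Icc α β) :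
    (β - α) / (x - α) ≤ ∫ y in Set.Ico α β, 1 / (x - y) ∧
      ∫ y in Set.Ico α β, 1 / (x - y) ≤ (β - α) / (x - β) := by
  have hint := integrableOn_one_div_sub hx
  have hc : ∀ c : ℝ, ∫ _ in Set.Ico α β, c = (β - α) * c := fun c => by
    simp [Real.volume_real_Ico_of_le hαβ.le]
  have hci : ∀ c : ℝ, IntegrableOn (fun _ => c) (Set.Ico α β) := fun c =>
    integrableOn_const (by simp)
  have hb : ∀ y ∈ Set.Ico α β, 1 / (x - α) ≤ 1 / (x - y) ∧ 1 / (x - y) ≤ 1 / (x - β) := by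
    intro y hy
    rcases lt_or_lt_of_notMem_Icc hx with h | h
    · constructor
      · exact one_div_le_one_div_of_le (by linarith [hy.2]) (by linarith [hy.1])
      · exact one_div_le_one_div_of_le (by linarith) (by linarith [hy.2])
    · constructor
      · exact one_div_le_one_div_of_neg_of_le (by linarith) (by linarith [hy.1])
      · exact one_div_le_one_div_of_neg_of_le (by linarith [hy.1]) (by linarith [hy.2])
  constructor
  · rw [div_eq_mul_one_div, ← hc]
    exact setIntegral_mono_on (hci _) hint measurableSet_Ico fun y hy => (hb y hy).1
  · rw [div_eq_mul_one_div, ← hc]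
    exact setIntegral_mono_on hint (hci _) measurableSet_Ico fun y hy => (hb y hy).2

/-! ### The test function -/

/-- The sum of the dipoles formed by the two cells of generation `n + 1` adjacent to the middle
third of an interval of generation `n < L`. -/
noncomputable def dipoleSum (L : ℕ) (y : ℝ) : ℝ :=
  ∑ n ∈ Finset.range L, ∑ m ∈ middleInts L n,
    ((adicCell L (n + 1) (3 * L * m + L - 1)).indicator 1 y -
      (adicCell L (n + 1) (3 * L * m + 2 * L)).indicator 1 y)

lemma emod_left_of_middle {L : ℕ} (hL : 0 < L) (m : ℤ) :
    (3 * L * m + L - 1) % (3 * L : ℤ) = L - 1 := by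
  rw [show (3 * L * m + L - 1 : ℤ) = (L - 1) + 3 * L * m by ring, Int.add_mul_emod_self_left]
  exact Int.emod_eq_of_lt (by omega) (by omega)

lemma emod_right_of_middle {L : ℕ} (hL : 0 < L) (m : ℤ) :
    (3 * L * m + 2 * L) % (3 * L : ℤ) = 2 * L := by
  rw [show (3 * L * m + 2 * L : ℤ) = 2 * L + 3 * L * m by ring, Int.add_mul_emod_self_left]
  exact Int.emod_eq_of_lt (by omega) (by omega)

lemma notMem_middleSet_of_left {L : ℕ} (hL : 0 < L) {n : ℕ} {m : ℤ} {y : ℝ}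
    (hy : y ∈ adicCell L (n + 1) (3 * L * m + L - 1)) : y ∉ middleSet L (n + 1) := by
  intro h
  rw [mem_middleSet_succ hL, show ⌊y * (3 * L : ℝ) ^ (n + 1)⌋ = _ from hy,
    emod_left_of_middle hL] at h
  omega

lemma notMem_middleSet_of_right {L : ℕ} (hL : 0 < L) {n : ℕ} {m : ℤ} {y : ℝ}
    (hy : y ∈ adicCell L (n + 1) (3 * L * m + 2 * L)) : y ∉ middleSet L (n + 1) := by
  intro h
  rw [mem_middleSet_succ hL, show ⌊y * (3 * L : ℝ) ^ (n + 1)⌋ = _ from hy,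
    emod_right_of_middle hL] at h
  omega

lemma dipoleSum_eq_zero {L : ℕ} (hL : 0 < L) {y : ℝ} (hy : y ∈ middleSet L L) :
    dipoleSum L y = 0 := by
  refine Finset.sum_eq_zero fun n hn => Finset.sum_eq_zero fun m _ => ?_
  have h : y ∈ middleSet L (n + 1) :=
    middleSet_antitone hL (Nat.succ_le_iff.2 (Finset.mem_range.1 hn)) hy
  rw [Set.indicator_of_notMem fun h' => notMem_middleSet_of_left hL h' h,
    Set.indicator_of_notMem fun h' => notMem_middleSet_of_right hL h' h, sub_zero]

lemma integrable_indicator_adicCell {L : ℕ} (hL : 0 < L) (n : ℕ) (m : ℤ) :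
    Integrable ((adicCell L n m).indicator (1 : ℝ → ℝ)) := by
  rw [integrable_indicator_iff (measurableSet_adicCell L n m)]
  exact integrableOn_const (volume_adicCell_ne_top hL n m)

lemma integrable_dipoleSum {L : ℕ} (hL : 0 < L) : Integrable (dipoleSum L) :=
  integrable_finsetSum _ fun _ _ => integrable_finsetSum _ fun _ _ =>
    (integrable_indicator_adicCell hL _ _).sub (integrable_indicator_adicCell hL _ _)

lemma measurable_dipoleSum (L : ℕ) : Measurable (dipoleSum L) :=
  Finset.measurable_fun_sum _ fun _ _ => Finset.measurable_fun_sum _ fun _ _ =>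
    (measurable_one.indicator (measurableSet_adicCell L _ _)).sub
      (measurable_one.indicator (measurableSet_adicCell L _ _))

lemma weightMeasure_adicCell_le {L n : ℕ} (hL : 0 < L) (hn : n < L) {m : ℤ}
    (h : ∀ y ∈ adicCell L (n + 1) m, y ∉ middleSet L (n + 1)) :
    weightMeasure (nestedWeight L) (adicCell L (n + 1) m) ≤
      ENNReal.ofReal (3 ^ (n + 1) / L * (1 / (3 * L) ^ (n + 1))) := by
  rw [weightMeasure, withDensity_apply _ (measurableSet_adicCell L _ _)]
  calc _ ≤ ∫⁻ _ in adicCell L (n + 1) m, ENNReal.ofReal (3 ^ (n + 1) / L) :=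
        setLIntegral_mono measurable_const fun y hy =>
          ENNReal.ofReal_le_ofReal (nestedWeight_le hL hn (h y hy))
    _ = _ := by
        rw [setLIntegral_const, ENNReal.ofReal_mul (by positivity), ← volume_real_adicCell hL _ m,
          ofReal_measureReal (volume_adicCell_ne_top hL _ m)]

lemma eLpNorm_dipoleSum_le {L : ℕ} (hL : 0 < L) :
    eLpNorm (dipoleSum L) 1 (weightMeasure (nestedWeight L)) ≤ ENNReal.ofReal (2 / L) := by
  have hind : ∀ n m, eLpNorm ((adicCell L n m).indicator (1 : ℝ → ℝ)) 1
      (weightMeasure (nestedWeight L)) = weightMeasure (nestedWeight L) (adicCell L n m) := by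
    intro n m
    rw [show (1 : ℝ → ℝ) = fun _ => (1 : ℝ) from rfl,
      eLpNorm_indicator_const (measurableSet_adicCell L n m) one_ne_zero ENNReal.one_ne_top]
    simp
  have hms : ∀ n m, AEStronglyMeasurable ((adicCell L n m).indicator (1 : ℝ → ℝ))
      (weightMeasure (nestedWeight L)) := fun n m =>
    (measurable_one.indicator (measurableSet_adicCell L n m)).aestronglyMeasurable
  have hterm : ∀ n ∈ Finset.range L, ∀ m ∈ middleInts L n,
      eLpNorm ((adicCell L (n + 1) (3 * L * m + L - 1)).indicator (1 : ℝ → ℝ) -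
        (adicCell L (n + 1) (3 * L * m + 2 * L)).indicator 1) 1
          (weightMeasure (nestedWeight L)) ≤
        ENNReal.ofReal (2 * (3 ^ (n + 1) / L * (1 / (3 * L) ^ (n + 1)))) := by
    intro n hn m _
    refine (eLpNorm_sub_le (hms _ _) (hms _ _) le_rfl).trans ?_
    rw [hind, hind, two_mul (3 ^ (n + 1) / (L : ℝ) * _), ENNReal.ofReal_add (by positivity) (by positivity)]
    have hn' := Finset.mem_range.1 hn
    exact add_le_add
      (weightMeasure_adicCell_le hL hn' fun _ hy => notMem_middleSet_of_left hL hy)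
      (weightMeasure_adicCell_le hL hn' fun _ hy => notMem_middleSet_of_right hL hy)
  have hsum : dipoleSum L = ∑ n ∈ Finset.range L, ∑ m ∈ middleInts L n,
      ((adicCell L (n + 1) (3 * L * m + L - 1)).indicator (1 : ℝ → ℝ) -
        (adicCell L (n + 1) (3 * L * m + 2 * L)).indicator 1) := by
    ext y; simp [dipoleSum, Finset.sum_apply]
  rw [hsum]
  refine (eLpNorm_sum_le (fun n _ => Finset.aestronglyMeasurable_sum _ fun m _ =>
    (hms _ _).sub (hms _ _)) le_rfl).trans ?_
  calc _ ≤ ∑ n ∈ Finset.range L, ∑ m ∈ middleInts L n,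
        ENNReal.ofReal (2 * (3 ^ (n + 1) / L * (1 / (3 * L) ^ (n + 1)))) :=
        Finset.sum_le_sum fun n hn => (eLpNorm_sum_le (fun m _ => (hms _ _).sub (hms _ _))
          le_rfl).trans (Finset.sum_le_sum (hterm n hn))
    -- The `L ^ n` dipoles of generation `n` balance the powers of `3` and `3 L`, so every
    -- generation costs the same.
    _ = ∑ n ∈ Finset.range L, ENNReal.ofReal (2 / L ^ 2) := by
        refine Finset.sum_congr rfl fun n _ => ?_
        rw [Finset.sum_const, card_middleInts, ← ENNReal.ofReal_nsmul]
        congr 1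
        have : (L : ℝ) ≠ 0 := by positivity
        rw [nsmul_eq_mul, mul_pow, pow_succ (L : ℝ) n]
        push_cast
        field_simp
    _ = _ := by
        rw [Finset.sum_const, Finset.card_range, ← ENNReal.ofReal_nsmul]
        congr 1
        have : (L : ℝ) ≠ 0 := by positivity
        rw [nsmul_eq_mul]
        field_simp

lemma integrable_dipoleSum_weightMeasure {L : ℕ} (hL : 0 < L) :
    Integrable (dipoleSum L) (weightMeasure (nestedWeight L)) :=
  memLp_one_iff_integrable.1 ⟨(measurable_dipoleSum L).aestronglyMeasurable,
    (eLpNorm_dipoleSum_le hL).trans_lt ENNReal.ofReal_lt_top⟩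

/-! ### Lower bound for the Hilbert transform of the test function -/

lemma notMem_Icc_of_nonint {L : ℕ} (hL : 0 < L) {n : ℕ} {c : ℤ} {x : ℝ}
    (hx : ∀ k : ℤ, x * (3 * L : ℝ) ^ n ≠ k) (hc : x ∉ adicCell L n c) :
    x ∉ Set.Icc (c / (3 * L : ℝ) ^ n) ((c + 1) / (3 * L : ℝ) ^ n) := by
  have hB : (0 : ℝ) < (3 * L : ℝ) ^ n := by positivity
  rw [adicCell_eq hL] at hc
  refine fun h => hc ⟨h.1, lt_of_le_of_ne h.2 fun h' => hx (c + 1) ?_⟩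
  rw [h', div_mul_cancel₀ _ hB.ne']
  push_cast
  rfl

lemma setIntegral_adicCell_bounds {L : ℕ} (hL : 0 < L) {n : ℕ} {c : ℤ} {x : ℝ}
    (hx : ∀ k : ℤ, x * (3 * L : ℝ) ^ n ≠ k) (hc : x ∉ adicCell L n c) :
    1 / (x * (3 * L : ℝ) ^ n - c) ≤ ∫ y in adicCell L n c, 1 / (x - y) ∧
      ∫ y in adicCell L n c, 1 / (x - y) ≤ 1 / (x * (3 * L : ℝ) ^ n - c - 1) := by
  have hB : (0 : ℝ) < (3 * L : ℝ) ^ n := by positivity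
  have h := setIntegral_one_div_sub_bounds (by gcongr; linarith) (notMem_Icc_of_nonint hL hx hc)
  rw [adicCell_eq hL]
  have e : ∀ z : ℝ, ((c + 1) / (3 * L : ℝ) ^ n - c / (3 * L : ℝ) ^ n) / (x - z / (3 * L : ℝ) ^ n)
      = 1 / (x * (3 * L : ℝ) ^ n - z) := by
    intro z
    rw [← sub_div, add_sub_cancel_left, div_div, mul_sub, mul_div_cancel₀ _ hB.ne', mul_comm x]
  rw [e, e, ← sub_sub] at h
  exact h

lemma integrable_indicator_mul_adicCell {L : ℕ} (hL : 0 < L) {n : ℕ} {c : ℤ} {x : ℝ}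
    (hx : ∀ k : ℤ, x * (3 * L : ℝ) ^ n ≠ k) (hc : x ∉ adicCell L n c) :
    Integrable ((adicCell L n c).indicator fun y => 1 / (x - y)) := by
  rw [integrable_indicator_iff (measurableSet_adicCell L n c), adicCell_eq hL]
  exact integrableOn_one_div_sub (notMem_Icc_of_nonint hL hx hc)

/-- Dipole cancellation: the two denominators have the same sign and differ by `l + 2 ≤ 3 l`, while
their product is at least `3 l² d²`. Here `d` is the offset between cells and `u` the position of
the point inside its own cell. -/
lemma neg_one_div_le_dipole {l u d : ℝ} (hl : 1 ≤ l) (hu : l ≤ u) (hu2 : u ≤ 2 * l)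
    (hd : 1 ≤ |d|) :
    -(1 / (l * d ^ 2)) ≤ 1 / (3 * l * d + u - l + 1) - 1 / (3 * l * d + u - 2 * l - 1) := by
  set P := 3 * l * d + u - l + 1 with hP
  set Q := 3 * l * d + u - 2 * l - 1 with hQ
  have hd2 : 0 < d ^ 2 := by rw [← sq_abs]; positivity
  have hPQ : 3 * l ^ 2 * d ^ 2 ≤ P * Q := by
    rcases le_abs'.1 hd with h | h
    · have h1 : l * -d ≤ -P := by nlinarith
      have h2 : 3 * l * -d ≤ -Q := by nlinarith
      have := mul_le_mul h1 h2 (by nlinarith) (by nlinarith)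
      nlinarith
    · have h1 : 3 * l * d ≤ P := by linarith
      have h2 : l * d ≤ Q := by nlinarith
      have := mul_le_mul h1 h2 (by nlinarith) (by nlinarith)
      nlinarith
  have hpos : 0 < P * Q := lt_of_lt_of_le (by positivity) hPQ
  have hP0 : P ≠ 0 := left_ne_zero_of_mul hpos.ne'
  have hQ0 : Q ≠ 0 := right_ne_zero_of_mul hpos.ne'
  rw [div_sub_div _ _ hP0 hQ0, neg_le, ← neg_div, show -(1 * Q - P * 1) = l + 2 by
    rw [hP, hQ]; ring]
  calc (l + 2) / (P * Q) ≤ (3 * l) / (3 * l ^ 2 * d ^ 2) := by gcongr; linarith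
    _ = _ := by field_simp

lemma dipole_integral_ge {L : ℕ} (hL : 0 < L) {n : ℕ} {m : ℤ} {x : ℝ}
    (hx : ∀ k : ℤ, x * (3 * L : ℝ) ^ (n + 1) ≠ k) (hxm : x ∈ middleSet L (n + 1)) :
    (if m = ⌊x * (3 * L : ℝ) ^ n⌋ then
        1 / (((⌊x * (3 * L : ℝ) ^ (n + 1)⌋ % (3 * L) - L : ℤ) : ℝ) + 2) else 0) -
      1 / L * (1 / ((⌊x * (3 * L : ℝ) ^ n⌋ - m : ℤ) : ℝ) ^ 2) ≤
    (∫ y in adicCell L (n + 1) (3 * L * m + L - 1), 1 / (x - y)) -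
      ∫ y in adicCell L (n + 1) (3 * L * m + 2 * L), 1 / (x - y) := by
  have hL' : (1 : ℝ) ≤ L := by exact_mod_cast hL
  have hleft := (setIntegral_adicCell_bounds hL hx
    fun h => notMem_middleSet_of_left hL (m := m) h hxm).1
  have hright := (setIntegral_adicCell_bounds hL hx
    fun h => notMem_middleSet_of_right hL (m := m) h hxm).2
  obtain ⟨-, h1, h2⟩ := (mem_middleSet_succ hL).1 hxm
  have hem := Int.emod_add_mul_ediv ⌊x * (3 * L : ℝ) ^ (n + 1)⌋ (3 * L)
  rw [floor_mul_pow_ediv hL] at hem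
  have hfl := Int.floor_le (x * (3 * L : ℝ) ^ (n + 1))
  have hfl2 := Int.lt_floor_add_one (x * (3 * L : ℝ) ^ (n + 1))
  set X := x * (3 * L : ℝ) ^ (n + 1)
  set m₀ := ⌊x * (3 * L : ℝ) ^ n⌋
  set d := ⌊X⌋ % (3 * L : ℤ)
  have hemR : (⌊X⌋ : ℝ) = d + 3 * L * m₀ := by exact_mod_cast hem.symm
  have h1R : (L : ℝ) ≤ d := by exact_mod_cast h1
  have h2R : (d : ℝ) + 1 ≤ 2 * L := by exact_mod_cast h2
  push_cast at hleft hright ⊢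
  refine le_trans ?_ (sub_le_sub hleft hright)
  by_cases hm : m = m₀
  · subst hm
    simp only [if_true, sub_self, ne_eq, OfNat.ofNat_ne_zero, not_false_eq_true, zero_pow,
      div_zero, mul_zero, sub_zero]
    -- The 2 is one unit for the width of the left subcell, measured from its far end, and one for
    -- the fractional part of `X`.
    have h3 : 1 / ((d : ℝ) - L + 2) ≤ 1 / (X - (3 * L * m₀ + L - 1)) :=
      one_div_le_one_div_of_le (by linarith) (by linarith)
    -- The negative subcell is to the right of `x`, so its contribution has the favourable sign and
    -- is dropped.
    have h4 : 1 / (X - (3 * L * m₀ + 2 * L) - 1) ≤ 0 :=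
      div_nonpos_of_nonneg_of_nonpos zero_le_one (by linarith)
    linarith
  · rw [if_neg hm]
    have hd : (1 : ℝ) ≤ |((m₀ - m : ℤ) : ℝ)| := by
      exact_mod_cast Int.one_le_abs (sub_ne_zero.2 (Ne.symm hm))
    have := neg_one_div_le_dipole (u := X - 3 * L * m₀) hL' (by linarith) (by linarith) hd
    push_cast at this
    refine le_trans (le_of_eq ?_) (this.trans (le_of_eq ?_))
    · rw [zero_sub, one_div_mul_one_div]
    · congr 2 <;> ring

/-- The sum of the inverse squares of the nonzero integers. -/
noncomputable def sumInvSq : ℝ := ∑' k : ℤ, 1 / (k : ℝ) ^ 2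

/-- The term `m = m₀` is harmless, as `1 / 0 = 0`. -/
lemma sum_one_div_sq_le (S : Finset ℤ) (m₀ : ℤ) :
    ∑ m ∈ S, 1 / ((m₀ - m : ℤ) : ℝ) ^ 2 ≤ sumInvSq := by
  rw [← Finset.sum_image (f := fun k : ℤ => 1 / (k : ℝ) ^ 2) (g := fun m => m₀ - m)
    (fun a _ b _ h => by simpa using h)]
  exact (Real.summable_one_div_int_pow.2 one_lt_two).sum_le_tsum _ fun _ _ => by positivity

lemma sumInvSq_nonneg : 0 ≤ sumInvSq := tsum_nonneg fun _ => by positivity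

/-- In each generation the cell containing `x` supplies one term of the digit sum and the other
cells cost at most `sumInvSq / L`; over `L` generations the errors total `sumInvSq`. -/
lemma hilbertTransform_dipoleSum_ge {L : ℕ} (hL : 0 < L) {x : ℝ}
    (hx : ∀ (n : ℕ) (k : ℤ), x * (3 * L : ℝ) ^ n ≠ k) (hxm : x ∈ middleSet L L) :
    digitSum L L ⌊x * (3 * L : ℝ) ^ L⌋ - sumInvSq ≤ hilbertTransform (dipoleSum L) x := by
  have hB : (0 : ℝ) < (3 * L : ℝ) ^ L := by positivity
  -- Not being a grid point, `x` is interior to its cell of generation `L`, where all dipoles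
  -- vanish.
  have hnhds : ∀ᶠ y in 𝓝 x, dipoleSum L y = 0 := by
    have : adicCell L L ⌊x * (3 * L : ℝ) ^ L⌋ ∈ 𝓝 x := by
      rw [adicCell_eq hL]
      refine Ico_mem_nhds ?_ ?_
      · rw [div_lt_iff₀ hB]
        exact lt_of_le_of_ne (Int.floor_le _) (hx L _).symm
      · rw [lt_div_iff₀ hB]
        exact Int.lt_floor_add_one _
    filter_upwards [this] with y hy
    refine dipoleSum_eq_zero hL ?_
    rw [middleSet, Set.mem_ofPred_eq, show ⌊y * (3 * L : ℝ) ^ L⌋ = _ from hy]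
    exact hxm
  rw [hilbertTransform_eq_integral (integrable_dipoleSum hL) hnhds]
  have hmem : ∀ n ∈ Finset.range L, x ∈ middleSet L (n + 1) := fun n hn =>
    middleSet_antitone hL (Nat.succ_le_iff.2 (Finset.mem_range.1 hn)) hxm
  have hil : ∀ n ∈ Finset.range L, ∀ m : ℤ,
      Integrable ((adicCell L (n + 1) (3 * L * m + L - 1)).indicator fun y => 1 / (x - y)) :=
    fun n hn m => integrable_indicator_mul_adicCell hL (hx _)
      fun h => notMem_middleSet_of_left hL h (hmem n hn)
  have hir : ∀ n ∈ Finset.range L, ∀ m : ℤ,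
      Integrable ((adicCell L (n + 1) (3 * L * m + 2 * L)).indicator fun y => 1 / (x - y)) :=
    fun n hn m => integrable_indicator_mul_adicCell hL (hx _)
      fun h => notMem_middleSet_of_right hL h (hmem n hn)
  have hid : ∀ n ∈ Finset.range L, ∀ m : ℤ, Integrable fun y =>
      (adicCell L (n + 1) (3 * L * m + L - 1)).indicator (fun y => 1 / (x - y)) y -
        (adicCell L (n + 1) (3 * L * m + 2 * L)).indicator (fun y => 1 / (x - y)) y :=
    fun n hn m => (hil n hn m).sub (hir n hn m)
  have hmul : ∀ (s : Set ℝ) (y : ℝ), s.indicator (1 : ℝ → ℝ) y / (x - y) =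
      s.indicator (fun y => 1 / (x - y)) y := fun s y => by
    by_cases h : y ∈ s <;> simp [h]
  have hexp : ∀ y, dipoleSum L y / (x - y) = ∑ n ∈ Finset.range L, ∑ m ∈ middleInts L n,
      ((adicCell L (n + 1) (3 * L * m + L - 1)).indicator (fun y => 1 / (x - y)) y -
        (adicCell L (n + 1) (3 * L * m + 2 * L)).indicator (fun y => 1 / (x - y)) y) := by
    intro y
    simp only [dipoleSum, Finset.sum_div, sub_div, hmul]
  simp only [hexp]
  rw [integral_finsetSum _ fun n hn => integrable_finsetSum _ fun m _ => hid n hn m]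
  have hstep : ∀ n ∈ Finset.range L,
      1 / (((⌊x * (3 * L : ℝ) ^ (n + 1)⌋ % (3 * L) - L : ℤ) : ℝ) + 2) - 1 / L * sumInvSq ≤
      ∫ y, ∑ m ∈ middleInts L n,
      ((adicCell L (n + 1) (3 * L * m + L - 1)).indicator (fun y => 1 / (x - y)) y -
        (adicCell L (n + 1) (3 * L * m + 2 * L)).indicator (fun y => 1 / (x - y)) y) := by
    intro n hn
    rw [integral_finsetSum _ fun m _ => hid n hn m]
    calc _ ≤ ∑ m ∈ middleInts L n, ((if m = ⌊x * (3 * L : ℝ) ^ n⌋ then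
            1 / (((⌊x * (3 * L : ℝ) ^ (n + 1)⌋ % (3 * L) - L : ℤ) : ℝ) + 2) else 0) -
          1 / L * (1 / ((⌊x * (3 * L : ℝ) ^ n⌋ - m : ℤ) : ℝ) ^ 2)) := by
          have hm₀ : ⌊x * (3 * L : ℝ) ^ n⌋ ∈ middleInts L n :=
            middleSet_antitone hL (Finset.mem_range.1 hn).le hxm
          rw [Finset.sum_sub_distrib, Finset.sum_ite_eq', if_pos hm₀, ← Finset.mul_sum]
          gcongr
          exact sum_one_div_sq_le _ _
      _ ≤ _ := by
          refine Finset.sum_le_sum fun m _ => ?_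
          rw [integral_sub (hil n hn m) (hir n hn m),
            integral_indicator (measurableSet_adicCell L _ _),
            integral_indicator (measurableSet_adicCell L _ _)]
          exact dipole_integral_ge hL (hx _) (hmem n hn)
  refine le_trans (le_of_eq ?_) (Finset.sum_le_sum hstep)
  rw [Finset.sum_sub_distrib, digitSum_floor hL, Finset.sum_const, Finset.card_range,
    nsmul_eq_mul]
  have : (L : ℝ) ≠ 0 := by positivity
  field_simp

/-! ### ### The weak-type quotient -/

/-- Each cell of `middleSet L L` has mass at least `3 ^ L / (3 L) ^ L = L ^ (-L)`; a countable set
removes nothing. -/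
lemma le_weightMeasure_of_subset {L : ℕ} (hL : 0 < L) {S : Finset ℤ} (hS : S ⊆ middleInts L L)
    {D : Set ℝ} (hD : D.Countable) :
    ENNReal.ofReal (S.card / (L : ℝ) ^ L) ≤
      weightMeasure (nestedWeight L) ((⋃ m ∈ S, adicCell L L m) \ D) := by
  have hmeas : MeasurableSet (⋃ m ∈ S, adicCell L L m) :=
    S.measurableSet_biUnion fun m _ => measurableSet_adicCell L L m
  have hvol : volume (⋃ m ∈ S, adicCell L L m) = ENNReal.ofReal (S.card / (3 * L : ℝ) ^ L) := by
    have hdisj : (S : Set ℤ).PairwiseDisjoint (adicCell L L) :=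
      fun i _ j _ hij => Set.disjoint_left.2 fun z hi hj => hij
        ((show ⌊z * (3 * L : ℝ) ^ L⌋ = i from hi).symm.trans hj)
    rw [measure_biUnion_finset hdisj fun m _ => measurableSet_adicCell L L m]
    simp only [← ofReal_measureReal (volume_adicCell_ne_top hL L _), volume_real_adicCell hL,
      Finset.sum_const]
    rw [← ENNReal.ofReal_nsmul, nsmul_eq_mul, mul_one_div]
  rw [weightMeasure, withDensity_apply _ (hmeas.diff hD.measurableSet)]
  calc ENNReal.ofReal (S.card / (L : ℝ) ^ L)
      = ∫⁻ _ in (⋃ m ∈ S, adicCell L L m) \ D, ENNReal.ofReal (3 ^ L) := by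
        rw [setLIntegral_const, measure_sdiff_null (hD.measure_zero _), hvol,
          ← ENNReal.ofReal_mul (by positivity)]
        congr 1
        have : (L : ℝ) ≠ 0 := by positivity
        rw [mul_pow]
        field_simp
    _ ≤ _ := by
        refine setLIntegral_mono (measurable_nestedWeight L).ennreal_ofReal fun y hy =>
          ENNReal.ofReal_le_ofReal (le_nestedWeight_of_mem ?_)
        rw [middleSet_eq_biUnion]
        exact Set.biUnion_subset_biUnion_left hS hy.1

lemma le_weakL1Norm {g : ℝ → ℝ} {μ : Measure ℝ} {α r : ℝ} (hα : 0 < α) {s : Set ℝ}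
    (hs : ∀ x ∈ s, α < |g x|) (hr : ENNReal.ofReal r ≤ μ s) :
    ENNReal.ofReal (α * r) ≤ weakL1Norm g μ := by
  rw [ENNReal.ofReal_mul hα.le]
  exact (mul_le_mul_right (hr.trans (measure_mono hs)) _).trans
    (le_iSup₂ (f := fun (α : ℝ) (_ : 0 < α) => ENNReal.ofReal α * μ {x | α < |g x|}) α hα)

lemma weakL1Norm_dipoleSum_ge {L : ℕ} (hlog : 4 * sumInvSq + 10 < Real.log L) :
    ENNReal.ofReal (Real.log L / 8) ≤
      weakL1Norm (hilbertTransform (dipoleSum L)) (weightMeasure (nestedWeight L)) := by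
  have hK := sumInvSq_nonneg
  have hL : 0 < L := by
    rcases Nat.eq_zero_or_pos L with h | h
    · subst h; simp at hlog; linarith
    · exact h
  have hH := shiftedHarmonic_ge L
  have hcard := card_large_digitSum (L := L) (by linarith)
  set S := (middleInts L L).filter fun y => shiftedHarmonic L / 2 ≤ digitSum L L y with hS
  -- The grid points of all generations, where the kernel estimates are not available.
  have hD : (⋃ (n : ℕ) (k : ℤ), {x : ℝ | x * (3 * L : ℝ) ^ n = k}).Countable := by
    refine Set.countable_iUnion fun n => Set.countable_iUnion fun k => ?_
    refine (Set.countable_singleton ((k : ℝ) / (3 * L : ℝ) ^ n)).mono fun x hx => ?_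
    have : (L : ℝ) ≠ 0 := by positivity
    rw [Set.mem_singleton_iff, eq_div_iff (by positivity)]
    exact hx
  have hmeas := le_weightMeasure_of_subset hL (S := S) (Finset.filter_subset _ _) hD
  rw [show Real.log L / 8 = Real.log L / 4 * (1 / 2) by ring]
  refine le_weakL1Norm (by linarith) (fun x hx => ?_) ((ENNReal.ofReal_le_ofReal ?_).trans hmeas)
  · obtain ⟨hx1, hx2⟩ := hx
    simp only [Set.mem_iUnion, Set.mem_ofPred_eq, not_exists] at hx1 hx2
    obtain ⟨m, hm, hxm⟩ := hx1
    have hm' := Finset.mem_filter.1 hm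
    have hfl : ⌊x * (3 * L : ℝ) ^ L⌋ = m := hxm
    have hge := hilbertTransform_dipoleSum_ge hL hx2 (by
      rw [middleSet, Set.mem_ofPred_eq, hfl]; exact hm'.1)
    rw [hfl] at hge
    refine lt_of_lt_of_le ?_ (le_abs_self _)
    -- The value is at least `(log L - 1) / 2 - sumInvSq`, which exceeds `log L / 4` by the choice
    -- of `hlog`.
    linarith [hm'.2]
  · rw [le_div_iff₀ (by positivity)]
    linarith

/-- A weak-type bound for the nested weight has a constant at least `L log L / 16`. -/
lemma le_of_weakL1Norm_dipoleSum_le {L : ℕ} (hlog : 4 * sumInvSq + 10 < Real.log L) {C : ℝ≥0∞}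
    (h : weakL1Norm (hilbertTransform (dipoleSum L)) (weightMeasure (nestedWeight L)) ≤
      C * eLpNorm (dipoleSum L) 1 (weightMeasure (nestedWeight L))) :
    ENNReal.ofReal (L * Real.log L / 16) ≤ C := by
  have hK := sumInvSq_nonneg
  have hL : 0 < L := by
    rcases Nat.eq_zero_or_pos L with h | h
    · subst h; simp at hlog; linarith
    · exact h
  have hL' : (L : ℝ) ≠ 0 := by positivity
  have h1 : ENNReal.ofReal (Real.log L / 8) ≤ C * ENNReal.ofReal (2 / L) :=
    (weakL1Norm_dipoleSum_ge hlog).trans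
      (h.trans (mul_le_mul_right (eLpNorm_dipoleSum_le hL) _))
  calc ENNReal.ofReal (L * Real.log L / 16)
      = ENNReal.ofReal (Real.log L / 8) * ENNReal.ofReal (L / 2) := by
        rw [← ENNReal.ofReal_mul (by linarith)]; congr 1; ring
    _ ≤ C * ENNReal.ofReal (2 / L) * ENNReal.ofReal (L / 2) := by gcongr
    _ = C := by
        rw [mul_assoc, ← ENNReal.ofReal_mul (by positivity),
          show (2 / L * (L / 2) : ℝ) = 1 by field_simp, ENNReal.ofReal_one, mul_one]

/-! ### ### Conclusion for `phiH` and for the exponent -/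

lemma le_phiH {w f : ℝ → ℝ} {t : ℝ} {r : ℝ≥0∞} (hw : IsWeight w)
    (ha : a1Const w ≤ ENNReal.ofReal t) (hf : Integrable f (weightMeasure w))
    (h : ∀ C, weakL1Norm (hilbertTransform f) (weightMeasure w) ≤
      C * eLpNorm f 1 (weightMeasure w) → r ≤ C) : r ≤ phiH t := by
  have h1 : r ≤ hilbertWeakNorm w := le_sInf fun C hC => h C (hC f hf)
  exact h1.trans (le_iSup_of_le w (le_iSup_of_le hw (le_iSup_of_le ha le_rfl)))

/-- This covers bounded `t`: for the constant weight and the indicator of `[0, 1)`, the transform is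
at least `1 / x > 1 / 2` on `(1, 5/4)`. -/
lemma eighth_le_phiH {t : ℝ} (ht : 1 ≤ t) : ENNReal.ofReal (1 / 8) ≤ phiH t := by
  have hμ : weightMeasure (fun _ => 1) = volume := by simp [weightMeasure]
  have hfi : Integrable ((Set.Ico (0 : ℝ) 1).indicator (1 : ℝ → ℝ)) := by
    rw [integrable_indicator_iff measurableSet_Ico]
    exact integrableOn_const (by simp)
  refine le_phiH (w := fun _ => 1) (f := (Set.Ico (0 : ℝ) 1).indicator 1)
    ⟨fun _ => zero_le_one, locallyIntegrable_const _⟩ ?_ (by rwa [hμ]) ?_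
  · refine essSup_le_of_ae_le _ (ae_of_all _ fun x => ?_)
    simp only [ENNReal.ofReal_one, div_one]
    refine iSup_le fun a => iSup_le fun b => iSup_le fun hab => iSup_le fun hx => ?_
    have : (∫⁻ _ in Set.Icc a b, ‖(1 : ℝ)‖ₑ) = ENNReal.ofReal (b - a) := by simp
    rw [this]
    exact ENNReal.div_self_le_one.trans (by simpa using ENNReal.ofReal_le_ofReal ht)
  · intro C hC
    have hnorm : eLpNorm ((Set.Ico (0 : ℝ) 1).indicator (1 : ℝ → ℝ)) 1 volume = 1 := by
      rw [show (1 : ℝ → ℝ) = fun _ => (1 : ℝ) from rfl,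
        eLpNorm_indicator_const measurableSet_Ico one_ne_zero ENNReal.one_ne_top]
      simp
    rw [hμ, hnorm, mul_one] at hC
    refine le_trans ?_ hC
    rw [show (1 / 8 : ℝ) = 1 / 2 * (1 / 4) by norm_num]
    refine le_weakL1Norm (s := Set.Ioo 1 (5 / 4)) (by norm_num) (fun x hx => ?_) ?_
    · rw [hilbertTransform_eq_integral hfi]
      · have hcongr : ∀ y, (Set.Ico (0 : ℝ) 1).indicator (1 : ℝ → ℝ) y / (x - y) =
            (Set.Ico (0 : ℝ) 1).indicator (fun y => 1 / (x - y)) y := fun y => by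
          by_cases h : y ∈ Set.Ico (0 : ℝ) 1 <;> simp [h]
        simp only [hcongr]
        rw [integral_indicator measurableSet_Ico]
        have h1 := (setIntegral_one_div_sub_bounds (x := x) zero_lt_one
          (fun h => absurd h.2 (not_le.2 hx.1))).1
        refine lt_of_lt_of_le ?_ (h1.trans (le_abs_self _))
        rw [lt_div_iff₀ (by linarith [hx.1])]
        linarith [hx.2]
      · filter_upwards [Ioi_mem_nhds hx.1] with y hy
        exact Set.indicator_of_notMem (fun h => absurd h.2 (not_lt.2 (le_of_lt hy))) _
    · rw [Real.volume_Ioo]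
      norm_num

lemma log_exp_one_add_le {L : ℕ} (hlog : 10 < Real.log L) {s : ℝ} (hs0 : 0 ≤ s)
    (hs : s ≤ 36 * L) : Real.log (Real.exp 1 + s) ≤ 2 * Real.log L := by
  have hL : (0 : ℝ) < L := by
    rcases Nat.eq_zero_or_pos L with h | h
    · subst h; simp at hlog; linarith
    · exact_mod_cast h
  have h61 : (61 : ℝ) ≤ L := by
    have h1 := (Real.lt_log_iff_exp_lt hL).1 hlog
    have h2 := Real.quadratic_le_exp_of_nonneg (x := 10) (by norm_num)
    linarith
  have he := Real.exp_one_lt_d9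
  have := Real.exp_pos 1
  rw [show (2 : ℝ) * Real.log L = Real.log (L ^ 2) by rw [Real.log_pow]; norm_num]
  exact Real.log_le_log (by linarith) (by nlinarith)

lemma eventually_lt_log_natCast (A : ℝ) : ∀ᶠ L : ℕ in atTop, A < Real.log L :=
  (Real.tendsto_log_atTop.comp tendsto_natCast_atTop_atTop).eventually_gt_atTop A

lemma exists_le_phiH : ∃ c : ℝ, 0 < c ∧ ∀ t : ℝ, 1 ≤ t →
    ENNReal.ofReal (c * t * Real.log (Real.exp 1 + t)) ≤ phiH t := by
  have hK := sumInvSq_nonneg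
  obtain ⟨L₀, hL₀⟩ := eventually_atTop.1 (eventually_lt_log_natCast (4 * sumInvSq + 10))
  set T : ℝ := 18 * (L₀ + 1) with hT
  have hT0 : 1 ≤ T := by
    have : (0 : ℝ) ≤ L₀ := by positivity
    linarith
  have hlogpos : ∀ s : ℝ, 0 ≤ s → 1 ≤ Real.log (Real.exp 1 + s) := fun s hs => by
    rw [Real.le_log_iff_exp_le (by positivity)]; linarith
  have hTlog := hlogpos T (by linarith)
  -- The second entry serves `t ≤ T`. The first serves `t > T`, where `t ≤ 36 L` and `log (e + t) ≤
  -- 2 log L` cost a factor 72, and `1152 = 16 * 72`.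
  refine ⟨min (1 / 1152) (1 / (8 * (T * Real.log (Real.exp 1 + T)))), by positivity, ?_⟩
  intro t ht
  have htlog := hlogpos t (by linarith)
  rcases le_or_gt t T with htT | htT
  · refine le_trans (ENNReal.ofReal_le_ofReal ?_) (eighth_le_phiH ht)
    calc _ ≤ 1 / (8 * (T * Real.log (Real.exp 1 + T))) * T * Real.log (Real.exp 1 + T) := by
          gcongr
          exact min_le_right _ _
      _ = 1 / 8 := by field_simp
  · set L := ⌊t / 18⌋₊
    have hfl : (L : ℝ) ≤ t / 18 := Nat.floor_le (by linarith)
    have hfl2 : t / 18 < L + 1 := Nat.lt_floor_add_one _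
    have hLL : L₀ + 1 ≤ L := Nat.le_floor (by push_cast; linarith)
    have hlog := hL₀ L (by omega)
    have hL1 : (1 : ℝ) ≤ L := by exact_mod_cast (show 1 ≤ L by omega)
    have hL : 0 < L := by omega
    have hlog2 := log_exp_one_add_le (L := L) (s := t) (by linarith) (by linarith) (by linarith)
    refine le_trans (ENNReal.ofReal_le_ofReal ?_) (le_phiH (isWeight_nestedWeight hL)
      ((a1Const_nestedWeight_le hL).trans (ENNReal.ofReal_le_ofReal (by linarith)))
      (integrable_dipoleSum_weightMeasure hL)
      fun C hC => le_of_weakL1Norm_dipoleSum_le hlog hC)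
    calc _ ≤ 1 / 1152 * (36 * L) * (2 * Real.log L) := by
          gcongr
          · exact min_le_left _ _
          · linarith
      _ = _ := by ring

lemma one_le_of_admissibleLogExponent {α : ℝ} (h : AdmissibleLogExponent α) : 1 ≤ α := by
  by_contra! hα
  obtain ⟨C, hC⟩ := h
  have hK := sumInvSq_nonneg
  -- Only an upper bound for the `A_1` constant is known, so a nonnegative exponent is needed to
  -- make the power of the logarithm monotone.
  set β := max α 0
  have hβ : 0 < 1 - β := sub_pos.2 (max_lt hα zero_lt_one)
  have htend : Tendsto (fun L : ℕ => (2 * Real.log L) ^ (1 - β)) atTop atTop :=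
    (tendsto_rpow_atTop hβ).comp ((Real.tendsto_log_atTop.comp
      tendsto_natCast_atTop_atTop).const_mul_atTop two_pos)
  obtain ⟨L, hlog, hbig⟩ := ((eventually_lt_log_natCast (4 * sumInvSq + 10)).and
    (htend.eventually_gt_atTop (576 * |C|))).exists
  have hL : 0 < L := by
    rcases Nat.eq_zero_or_pos L with h | h
    · subst h; simp at hlog; linarith
    · exact h
  have hL' : (0 : ℝ) < L := by positivity
  have ha := a1Const_nestedWeight_le hL
  have hmain := le_of_weakL1Norm_dipoleSum_le hlog (hC _ (isWeight_nestedWeight hL)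
    (ha.trans_lt ENNReal.ofReal_lt_top).ne _ (integrable_dipoleSum_weightMeasure hL))
  set A := (a1Const (nestedWeight L)).toReal
  have hA0 : 0 ≤ A := ENNReal.toReal_nonneg
  have hA : A ≤ 18 * L := ENNReal.toReal_le_of_le_ofReal (by positivity) ha
  have hlog1 : 1 ≤ Real.log (Real.exp 1 + A) := by
    rw [Real.le_log_iff_exp_le (by positivity)]; linarith
  have hlog2 := log_exp_one_add_le (L := L) (s := A) (by linarith) hA0 (by linarith)
  have hpow : Real.log (Real.exp 1 + A) ^ α ≤ (2 * Real.log L) ^ β :=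
    (Real.rpow_le_rpow_of_exponent_le hlog1 (le_max_left α 0)).trans
      (Real.rpow_le_rpow (by linarith) hlog2 (le_max_right α 0))
  have hle : (L : ℝ) * Real.log L / 16 ≤ |C| * (18 * L) * (2 * Real.log L) ^ β := by
    have hpos : 0 < (L : ℝ) * Real.log L / 16 := by
      have : 0 < Real.log L := by linarith
      positivity
    rcases ENNReal.ofReal_le_ofReal_iff'.1 hmain with h | h
    · refine h.trans ?_
      gcongr
      exact le_abs_self C
    · linarith
  have hX : 0 < 2 * Real.log L := by linarith
  have hXβ : 0 < (2 * Real.log L) ^ β := Real.rpow_pos_of_pos hX _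
  have hsplit : 2 * Real.log L = (2 * Real.log L) ^ (1 - β) * (2 * Real.log L) ^ β := by
    rw [← Real.rpow_add hX, sub_add_cancel, Real.rpow_one]
  have h1 : 2 * Real.log L ≤ 576 * |C| * (2 * Real.log L) ^ β := by
    refine le_of_mul_le_mul_left ?_ hL'
    linarith
  have h2 := mul_lt_mul_of_pos_right hbig hXβ
  linarith

theorem theorem1 :
    (∃ c : ℝ, 0 < c ∧ ∀ t : ℝ, 1 ≤ t →
      ENNReal.ofReal (c * t * Real.log (Real.exp 1 + t)) ≤ phiH t) ∧
    (∀ α : ℝ, AdmissibleLogExponent α → 1 ≤ α) :=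
  ⟨exists_le_phiH, fun _ h => one_le_of_admissibleLogExponent h⟩
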